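/- Let $\mathbb K$ be $\mathbb R$ or $\mathbb C$, let $G$ be a locally compact Hausdorff group with a fixed left Haar measure $ds$, and let $\mathcal X$ be a non-empty class of Banach spaces over $\mathbb K$. Let $\mathcal R$ be the class of all isometric strongly continuous representations of $G$ in spaces from $\mathcal X$, i.e. of all pairs $(X,U)$ where $X\in\mathcal X$ and $U$ is a homomorphism from $G$ into the group of invertible bounded operators on $X$ such that $r\mapsto U_rx$ is continuous for all $x\in X$ and $\|U_rx\|=\|x\|$ for all $r\in G$, $x\in X$. For $(X,U)\in\mathcal R$ and $f\in C_c(G)$ ($\mathbb K$-valued) put $U(f)x=\int_G f(s)U_sx\,ds$ $(x\in X)$. Equip $C_c(G)$ with the convolution product $(f*g)(s)=\int_G f(r)g(r^{-1}s)\,dr$ and the algebra seminorm $\sigma^{\mathcal R}(f)=\sup_{U\in\mathcal R}\|U(f)\|$. Let the group Banach algebra $\mathcal B_{\mathcal X}(G)=(\mathbb K\rtimes_{\mathrm{triv}}G)^{\mathcal R}$ be the Banach algebra obtained as the completion of $C_c(G)/\ker\sigma^{\mathcal R}$ in the norm induced by $\sigma^{\mathcal R}$, with canonical homomorphism $q^{\mathcal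 R}:C_c(G)\to\mathcal B_{\mathcal X}(G)$. For $U\in\mathcal R$ on $X$, let $U^{\mathcal R}:\mathcal B_{\mathcal X}(G)\to B(X)$ be the bounded representation determined by $U^{\mathcal R}(q^{\mathcal R}(f))=U(f)$ for all $f\in C_c(G)$. Then $U\mapsto U^{\mathcal R}$ (which keeps the representation space) is a bijection from $\mathcal R$ onto the class of all non-degenerate contractive representations of $\mathcal B_{\mathcal X}(G)$ in spaces from $\mathcal X$, i.e. of all pairs $(X,T)$ where $X\in\mathcal X$ and $T:\mathcal B_{\mathcal X}(G)\to B(X)$ is an algebra homomorphism such that $\|T(a)\|\le\|a\|$ for all $a$ and the linear span of all $T(a)x$ is dense in $X$. Moreover, for $U\in\mathcal R$, a closed subspace of the representation space is invariant under all $U_r$ $(r\in G)$ if and only if it is invariant under all $U^{\mathcal R}(a)$ $(a\in\mathcal B_{\mathcal X}(G))$; and for $U,V\in\mathcal R$ on $X$ and $Y$, a bounded operator $\Phi:X\to Y$ satisfies $V_r\Phi=\Phi U_r$ for all $r\in G$ if and only if $V^{\mathcal R}(a)\Phi=\Phi U^{\mathcal R}(a)$ for all $a\in\mathcal B_{\mathcal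 X}(G)$, so that the Banach spaces of bounded intertwining operators coincide. -/

import Mathlib

universe w u v

noncomputable section

set_option linter.unusedSectionVars false

open MeasureTheory Function Set

namespace BanachCrossed

/-! ### Banach spaces and representations -/

/-- A Banach space over `𝕜`; a class of Banach spaces is a `Set (BanachSpace 𝕜)`. -/
structure BanachSpace (𝕜 : Type w) [RCLike 𝕜] : Type (max w (v + 1)) where
  /-- the underlying type -/
  carrier : Type v
  [normedAddCommGroup : NormedAddCommGroup carrier]
  [normedSpace : NormedSpace 𝕜 carrier]
  [completeSpace : CompleteSpace carrier]

instance (𝕜 : Type w) [RCLike 𝕜] : CoeSort (BanachSpace.{w, v} 𝕜) (Type v) :=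
  ⟨BanachSpace.carrier⟩

attribute [instance] BanachSpace.normedAddCommGroup BanachSpace.normedSpace
  BanachSpace.completeSpace

/-- The underlying real structure, needed only to form Bochner integrals. -/
instance BanachSpace.realNormedSpace {𝕜 : Type w} [RCLike 𝕜] (X : BanachSpace.{w, v} 𝕜) :
    NormedSpace ℝ X :=
  NormedSpace.restrictScalars ℝ 𝕜 X

instance BanachSpace.realScalarTower {𝕜 : Type w} [RCLike 𝕜] (X : BanachSpace.{w, v} 𝕜) :
    IsScalarTower ℝ 𝕜 X :=
  RestrictScalars.isScalarTower ℝ 𝕜 X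

/-- A strongly continuous representation of `G` on the Banach space `X`: a group homomorphism
into the invertible bounded operators such that `r ↦ U_r x` is continuous for every `x`. -/
@[ext]
structure StrongRep (𝕜 : Type w) [RCLike 𝕜] (G : Type u) [Group G] [TopologicalSpace G]
    (X : BanachSpace.{w, v} 𝕜) where
  /-- the homomorphism into the group of invertible bounded operators -/
  hom : G →* (X →L[𝕜] X)ˣ
  continuous_apply : ∀ x : X, Continuous fun r : G => (hom r : X →L[𝕜] X) x

section GroupReps

variable {𝕜 : Type w} [RCLike 𝕜] {G : Type u} [Group G] [TopologicalSpace G]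
  {X Y : BanachSpace.{w, v} 𝕜}

/-- The bounded operator `U_r`. -/
def StrongRep.op (U : StrongRep 𝕜 G X) (r : G) : X →L[𝕜] X := (U.hom r : X →L[𝕜] X)

/-- `U` acts by isometries. -/
def StrongRep.IsIsometric (U : StrongRep 𝕜 G X) : Prop :=
  ∀ (r : G) (x : X), ‖U.op r x‖ = ‖x‖

/-- The closed subspaces invariant under all `U_r`. -/
def StrongRep.closedInvariantSubspaces (U : StrongRep 𝕜 G X) : Set (Submodule 𝕜 X) :=
  {Z | IsClosed (Z : Set X) ∧ ∀ (r : G), ∀ z ∈ Z, U.op r z ∈ Z}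

/-- The bounded intertwining operators between `U` and `V`, as a subspace of the bounded
operators from `X` to `Y` with the operator norm. -/
def StrongRep.intertwiners (U : StrongRep 𝕜 G X) (V : StrongRep 𝕜 G Y) :
    Submodule 𝕜 (X →L[𝕜] Y) where
  carrier := {Φ | ∀ r : G, (V.op r).comp Φ = Φ.comp (U.op r)}
  add_mem' := by
    intro Φ Ψ hΦ hΨ r
    simp only [mem_ofPred_eq] at hΦ hΨ
    rw [ContinuousLinearMap.comp_add, ContinuousLinearMap.add_comp, hΦ r, hΨ r]
  zero_mem' := by
    intro r
    simp
  smul_mem' := by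
    intro c Φ hΦ r
    simp only [mem_ofPred_eq] at hΦ
    rw [ContinuousLinearMap.comp_smul, ContinuousLinearMap.smul_comp, hΦ r]

/-- The trivial representation. -/
def StrongRep.trivial (𝕜 : Type w) [RCLike 𝕜] (G : Type u) [Group G] [TopologicalSpace G]
    (X : BanachSpace.{w, v} 𝕜) : StrongRep 𝕜 G X where
  hom := 1
  continuous_apply := fun x => by simpa using continuous_const

end GroupReps

section AlgebraReps

variable {𝕜 : Type w} [RCLike 𝕜] {A : Type u} [NonUnitalNormedRing A] [NormedSpace 𝕜 A]
  {X Y : BanachSpace.{w, v} 𝕜}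

/-- A representation of the (possibly non-unital) algebra `A` on `X` is an algebra homomorphism
from `A` into the bounded operators on `X`; neither boundedness nor unitality is required. -/
abbrev AlgRep (𝕜 : Type w) [RCLike 𝕜] (A : Type u) [NonUnitalNormedRing A] [NormedSpace 𝕜 A]
    (X : BanachSpace.{w, v} 𝕜) :=
  A →ₙₐ[𝕜] (X →L[𝕜] X)

/-- The linear span of all `T(a)x` is dense in `X`. -/
def AlgRep.IsNondegenerate (T : AlgRep 𝕜 A X) : Prop :=
  Dense (Submodule.span 𝕜 {y : X | ∃ (a : A) (x : X), T a x = y} : Set X)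

/-- `T` has norm at most one. -/
def AlgRep.IsContractive (T : AlgRep 𝕜 A X) : Prop :=
  ∀ a : A, ‖T a‖ ≤ ‖a‖

/-- The closed subspaces invariant under all `T(a)`. -/
def AlgRep.closedInvariantSubspaces (T : AlgRep 𝕜 A X) : Set (Submodule 𝕜 X) :=
  {Z | IsClosed (Z : Set X) ∧ ∀ (a : A), ∀ z ∈ Z, T a z ∈ Z}

/-- The bounded intertwining operators between `T` and `S`, as a subspace of the bounded
operators from `X` to `Y` with the operator norm. -/
def AlgRep.intertwiners (T : AlgRep 𝕜 A X) (S : AlgRep 𝕜 A Y) :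
    Submodule 𝕜 (X →L[𝕜] Y) where
  carrier := {Φ | ∀ a : A, (S a).comp Φ = Φ.comp (T a)}
  add_mem' := by
    intro Φ Ψ hΦ hΨ a
    simp only [mem_ofPred_eq] at hΦ hΨ
    rw [ContinuousLinearMap.comp_add, ContinuousLinearMap.add_comp, hΦ a, hΨ a]
  zero_mem' := by
    intro a
    simp
  smul_mem' := by
    intro c Φ hΦ a
    simp only [mem_ofPred_eq] at hΦ
    rw [ContinuousLinearMap.comp_smul, ContinuousLinearMap.smul_comp, hΦ a]

/-- All pairs `(X, T)` with `X` in the class `𝓧` and `T` a non-degenerate contractive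
representation of `A` on `X`. -/
def ndContractiveReps (A : Type u) [NonUnitalNormedRing A] [NormedSpace 𝕜 A]
    (𝓧 : Set (BanachSpace.{w, v} 𝕜)) : Set (Σ X : BanachSpace.{w, v} 𝕜, AlgRep 𝕜 A X) :=
  {T | T.1 ∈ 𝓧 ∧ AlgRep.IsNondegenerate T.2 ∧ AlgRep.IsContractive T.2}

end AlgebraReps

/-! ### The convolution algebra -/

/-- The space of compactly supported continuous functions on `G`, to be equipped with the
convolution product with respect to `μ`. -/
def ConvAlgebra (𝕜 : Type w) [RCLike 𝕜] (G : Type u) [TopologicalSpace G] [MeasurableSpace G]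
    (_μ : Measure G) : Type (max u w) :=
  CompactlySupportedContinuousMap G 𝕜

section Conv

variable {𝕜 : Type w} [RCLike 𝕜] {G : Type u} [Group G] [TopologicalSpace G]
  [IsTopologicalGroup G] [LocallyCompactSpace G] [MeasurableSpace G] [BorelSpace G]
  {μ : Measure G}

instance : AddCommGroup (ConvAlgebra 𝕜 G μ) :=
  inferInstanceAs (AddCommGroup (CompactlySupportedContinuousMap G 𝕜))

instance : Module 𝕜 (ConvAlgebra 𝕜 G μ) :=
  inferInstanceAs (Module 𝕜 (CompactlySupportedContinuousMap G 𝕜))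

instance : FunLike (ConvAlgebra 𝕜 G μ) G 𝕜 :=
  inferInstanceAs (FunLike (CompactlySupportedContinuousMap G 𝕜) G 𝕜)

namespace ConvAlgebra

@[ext]
theorem ext {f g : ConvAlgebra 𝕜 G μ} (h : ∀ s, f s = g s) : f = g :=
  DFunLike.ext _ _ h

theorem continuous (f : ConvAlgebra 𝕜 G μ) : Continuous f :=
  ContinuousMap.continuous (CompactlySupportedContinuousMap.toContinuousMap f)

theorem hasCompactSupport (f : ConvAlgebra 𝕜 G μ) : HasCompactSupport f :=
  CompactlySupportedContinuousMap.hasCompactSupport' f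

@[simp] theorem add_apply (f g : ConvAlgebra 𝕜 G μ) (s : G) : (f + g) s = f s + g s := rfl

@[simp] theorem zero_apply (s : G) : (0 : ConvAlgebra 𝕜 G μ) s = 0 := rfl

@[simp] theorem smul_apply (c : 𝕜) (f : ConvAlgebra 𝕜 G μ) (s : G) : (c • f) s = c * f s := rfl

section Integral

variable {E : Type*} [NormedAddCommGroup E] [NormedSpace 𝕜 E]

theorem integrable_smul [IsFiniteMeasureOnCompacts μ] (f : ConvAlgebra 𝕜 G μ) {F : G → E}
    (hF : Continuous F) : Integrable (fun s => f s • F s) μ :=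
  (f.continuous.smul hF).integrable_of_hasCompactSupport f.hasCompactSupport.smul_right

end Integral

variable [μ.IsHaarMeasure]

theorem continuous_conv (f g : ConvAlgebra 𝕜 G μ) :
    Continuous fun s => ∫ r, f r * g (r⁻¹ * s) ∂μ := by
  rw [← continuousOn_univ]
  refine continuousOn_integral_of_compact_support (k := tsupport f) f.hasCompactSupport ?_ ?_
  · refine Continuous.continuousOn ?_
    exact (f.continuous.comp continuous_snd).mul
      (g.continuous.comp (continuous_snd.inv.mul continuous_fst))
  · intro p x _ hx
    rw [image_eq_zero_of_notMem_tsupport hx, zero_mul]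

theorem hasCompactSupport_conv (f g : ConvAlgebra 𝕜 G μ) :
    HasCompactSupport fun s => ∫ r, f r * g (r⁻¹ * s) ∂μ := by
  refine HasCompactSupport.of_support_subset_isCompact
    (IsCompact.image (f.hasCompactSupport.prod g.hasCompactSupport) continuous_mul) ?_
  intro s hs
  by_contra hn
  apply hs
  have : ∀ r, f r * g (r⁻¹ * s) = 0 := by
    intro r
    by_contra hr
    apply hn
    refine ⟨(r, r⁻¹ * s), ⟨subset_tsupport _ (left_ne_zero_of_mul hr),
      subset_tsupport _ (right_ne_zero_of_mul hr)⟩, by simp⟩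
  simp [this]

/-- The convolution product `(f * g)(s) = ∫ f(r) g(r⁻¹ s) dr`. -/
instance : Mul (ConvAlgebra 𝕜 G μ) where
  mul f g :=
    ({ toFun := fun s => ∫ r, f r * g (r⁻¹ * s) ∂μ
       continuous_toFun := continuous_conv f g
       hasCompactSupport' := hasCompactSupport_conv f g } :
      CompactlySupportedContinuousMap G 𝕜)

theorem mul_apply (f g : ConvAlgebra 𝕜 G μ) (s : G) :
    (f * g) s = ∫ r, f r * g (r⁻¹ * s) ∂μ := rfl

/-- Fubini for the convolution product. -/
theorem integral_mul_smul {E : Type*} [NormedAddCommGroup E] [NormedSpace 𝕜 E]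
    [NormedSpace ℝ E] [IsScalarTower ℝ 𝕜 E] [CompleteSpace E]
    (f g : ConvAlgebra 𝕜 G μ) {F : G → E} (hF : Continuous F) :
    ∫ s, (f * g) s • F s ∂μ = ∫ r, f r • ∫ s, g s • F (r * s) ∂μ ∂μ := by
  have h1 : ∀ s, (f * g) s • F s = ∫ r, (f r * g (r⁻¹ * s)) • F s ∂μ := by
    intro s
    rw [mul_apply, integral_smul_const]
  have h2 : ∀ r, f r • ∫ s, g s • F (r * s) ∂μ = ∫ s, (f r * g (r⁻¹ * s)) • F s ∂μ := by
    intro r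
    rw [← integral_mul_left_eq_self (fun s => (f r * g (r⁻¹ * s)) • F s) r, ← integral_smul]
    simp [mul_smul]
  simp_rw [h1, h2]
  refine integral_integral_swap_of_hasCompactSupport (f := fun s r =>
    (f r * g (r⁻¹ * s)) • F s) ?_ ?_
  · exact ((f.continuous.comp continuous_snd).mul
      (g.continuous.comp (continuous_snd.inv.mul continuous_fst))).smul
      (hF.comp continuous_fst)
  · refine HasCompactSupport.of_support_subset_isCompact
      (IsCompact.image (f.hasCompactSupport.prod g.hasCompactSupport)
        (f := fun p : G × G => (p.1 * p.2, p.1)) (by fun_prop)) ?_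
    rintro ⟨s, r⟩ hs
    have hs' : (f r * g (r⁻¹ * s)) • F s ≠ 0 := hs
    have hne : f r * g (r⁻¹ * s) ≠ 0 := fun h0 => hs' (by rw [h0, zero_smul])
    refine ⟨(r, r⁻¹ * s), ⟨subset_tsupport _ (left_ne_zero_of_mul hne),
      subset_tsupport _ (right_ne_zero_of_mul hne)⟩, by simp⟩

theorem integrable_conv (f g : ConvAlgebra 𝕜 G μ) (s : G) :
    Integrable (fun r => f r * g (r⁻¹ * s)) μ :=
  f.integrable_smul (g.continuous.comp (continuous_inv.mul continuous_const))

instance : NonUnitalRing (ConvAlgebra 𝕜 G μ) :=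
  { (inferInstance : AddCommGroup (ConvAlgebra 𝕜 G μ)),
    (inferInstance : Mul (ConvAlgebra 𝕜 G μ)) with
    left_distrib := by
      intro f g h
      ext s
      simp only [mul_apply, add_apply, mul_add]
      exact integral_add (integrable_conv f g s) (integrable_conv f h s)
    right_distrib := by
      intro f g h
      ext s
      simp only [mul_apply, add_apply, add_mul]
      exact integral_add (integrable_conv f h s) (integrable_conv g h s)
    zero_mul := by
      intro f
      ext s
      simp [mul_apply]
    mul_zero := by
      intro f
      ext s
      simp [mul_apply]
    mul_assoc := by
      intro f g h
      ext t
      have := integral_mul_smul f g (F := fun s => h (s⁻¹ * t))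
        (h.continuous.comp (continuous_inv.mul continuous_const))
      simp only [smul_eq_mul, mul_inv_rev] at this
      rw [mul_apply, this, mul_apply]
      simp only [mul_apply, mul_assoc] }

instance : IsScalarTower 𝕜 (ConvAlgebra 𝕜 G μ) (ConvAlgebra 𝕜 G μ) where
  smul_assoc := by
    intro c f g
    ext s
    simp only [smul_eq_mul, smul_apply, mul_apply, mul_assoc]
    exact integral_const_mul _ _

instance : SMulCommClass 𝕜 (ConvAlgebra 𝕜 G μ) (ConvAlgebra 𝕜 G μ) where
  smul_comm := by
    intro c f g
    ext s
    simp only [smul_eq_mul, smul_apply, mul_apply, mul_left_comm _ c]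
    exact (integral_const_mul _ _).symm

end ConvAlgebra

/-! ### Integrated forms -/

variable {X : BanachSpace.{w, v} 𝕜}

theorem StrongRep.norm_integral_le [IsFiniteMeasureOnCompacts μ] (U : StrongRep 𝕜 G X)
    (f : ConvAlgebra 𝕜 G μ) {M : ℝ}
    (hM : ∀ s ∈ tsupport f, ‖U.op s‖ ≤ M) (x : X) :
    ‖∫ s, f s • U.op s x ∂μ‖ ≤ ((∫ s, ‖f s‖ ∂μ) * M) * ‖x‖ := by
  have hf : Integrable (fun s => ‖f s‖) μ :=
    (f.continuous.integrable_of_hasCompactSupport f.hasCompactSupport).norm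
  rw [← integral_mul_const, ← integral_mul_const]
  refine norm_integral_le_of_norm_le ((hf.mul_const _).mul_const _)
    (Filter.Eventually.of_forall fun s => ?_)
  rw [norm_smul, mul_assoc]
  by_cases hs : s ∈ tsupport f
  · exact mul_le_mul_of_nonneg_left
      (((U.op s).le_opNorm x).trans (mul_le_mul_of_nonneg_right (hM s hs) (norm_nonneg _)))
      (norm_nonneg _)
  · simp [image_eq_zero_of_notMem_tsupport hs]

theorem StrongRep.exists_bound (U : StrongRep 𝕜 G X) {K : Set G} (hK : IsCompact K) :
    ∃ M : ℝ, ∀ s ∈ K, ‖U.op s‖ ≤ M := by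
  obtain ⟨M, hM⟩ := banach_steinhaus (g := fun s : K => U.op s) (fun x => by
    obtain ⟨C, hC⟩ := hK.exists_bound_of_continuousOn (U.continuous_apply x).continuousOn
    exact ⟨C, fun s => hC s s.2⟩)
  exact ⟨M, fun s hs => hM ⟨s, hs⟩⟩

variable [μ.IsHaarMeasure]

/-- The operator `U(f)`, given by `U(f)x = ∫ f(s) U_s x ds`. -/
def StrongRep.integralOp (U : StrongRep 𝕜 G X) (f : ConvAlgebra 𝕜 G μ) : X →L[𝕜] X :=
  LinearMap.mkContinuousOfExistsBound
    { toFun := fun x => ∫ s, f s • U.op s x ∂μ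
      map_add' := fun x y => by
        simp only [map_add, smul_add]
        exact integral_add (f.integrable_smul (U.continuous_apply x))
          (f.integrable_smul (U.continuous_apply y))
      map_smul' := fun c x => by
        simp only [map_smul, smul_comm _ c, RingHom.id_apply]
        exact integral_smul c _ }
    (by
      obtain ⟨M, hM⟩ := U.exists_bound f.hasCompactSupport.isCompact
      exact ⟨_, U.norm_integral_le f hM⟩)

theorem StrongRep.integralOp_apply (U : StrongRep 𝕜 G X) (f : ConvAlgebra 𝕜 G μ) (x : X) :
    U.integralOp f x = ∫ s, f s • U.op s x ∂μ := rfl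

/-- The integrated form `f ↦ U(f)` of `U`, a representation of the convolution algebra. -/
def StrongRep.integrated (μ : Measure G) [μ.IsHaarMeasure] (U : StrongRep 𝕜 G X) :
    ConvAlgebra 𝕜 G μ →ₙₐ[𝕜] (X →L[𝕜] X) where
  toFun := U.integralOp
  map_smul' := fun c f => by
    ext x
    simp only [integralOp_apply, ConvAlgebra.smul_apply, mul_smul, MonoidHom.id_apply,
      _root_.smul_apply]
    exact integral_smul c _
  map_zero' := by
    ext x
    simp [integralOp_apply]
  map_add' := fun f g => by
    ext x
    simp only [integralOp_apply, ConvAlgebra.add_apply, add_smul,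
      _root_.add_apply]
    exact integral_add (f.integrable_smul (U.continuous_apply x))
      (g.integrable_smul (U.continuous_apply x))
  map_mul' := fun f g => by
    ext x
    have h := ConvAlgebra.integral_mul_smul f g (F := fun s => U.op s x)
      (U.continuous_apply x)
    rw [integralOp_apply, h]
    simp only [mul_apply_eq_comp, integralOp_apply]
    congr 1
    ext r
    congr 1
    refine Eq.trans ?_ (ContinuousLinearMap.integral_comp_comm (U.op r)
      (g.integrable_smul (U.continuous_apply x)))
    congr 1
    ext s
    simp [op, map_mul]

theorem StrongRep.integrated_apply (U : StrongRep 𝕜 G X) (f : ConvAlgebra 𝕜 G μ) (x : X) :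
    U.integrated μ f x = ∫ s, f s • U.op s x ∂μ := rfl

end Conv

/-! ### The crossed product associated with a class of representations -/

/-- A non-empty class of strongly continuous representations of `G` on Banach spaces which is
uniformly bounded: there is `ν : G → [0, ∞)`, bounded on compact sets, with `‖U_r‖ ≤ ν r` for
all `U` in the class and all `r`. -/
structure RepClass (𝕜 : Type w) [RCLike 𝕜] (G : Type u) [Group G] [TopologicalSpace G] where
  /-- the members of the class -/
  reps : Set (Σ X : BanachSpace.{w, v} 𝕜, StrongRep 𝕜 G X)
  nonempty : reps.Nonempty
  bounded : ∃ ν : G → NNReal, (∀ K : Set G, IsCompact K → BddAbove (ν '' K)) ∧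
    ∀ U ∈ reps, ∀ r : G, ‖U.2.op r‖ ≤ ν r

section Crossed

variable {𝕜 : Type w} [RCLike 𝕜] {G : Type u} [Group G] [TopologicalSpace G]
  [IsTopologicalGroup G] [LocallyCompactSpace G] [MeasurableSpace G] [BorelSpace G]
  {μ : Measure G} [μ.IsHaarMeasure]

/-- The seminorm `σ(f) = sup ‖U(f)‖`, the supremum being over all `U` in the class. -/
def RepClass.sigma (R : RepClass.{w, u, v} 𝕜 G) (f : ConvAlgebra 𝕜 G μ) : ℝ :=
  ⨆ U : R.reps, ‖U.1.2.integrated μ f‖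

theorem RepClass.bddAbove (R : RepClass.{w, u, v} 𝕜 G) (f : ConvAlgebra 𝕜 G μ) :
    BddAbove (range fun U : R.reps => ‖U.1.2.integrated μ f‖) := by
  obtain ⟨ν, hν, hR⟩ := R.bounded
  obtain ⟨M, hM⟩ := hν _ f.hasCompactSupport.isCompact
  refine ⟨(∫ s, ‖f s‖ ∂μ) * M, ?_⟩
  rintro _ ⟨U, rfl⟩
  refine ContinuousLinearMap.opNorm_le_bound _
    (mul_nonneg (integral_nonneg fun _ => norm_nonneg _) M.2) fun x => ?_
  refine U.1.2.norm_integral_le f (fun s hs => (hR _ U.2 s).trans ?_) x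
  exact_mod_cast hM (mem_image_of_mem ν hs)

theorem RepClass.norm_le_sigma (R : RepClass.{w, u, v} 𝕜 G) (f : ConvAlgebra 𝕜 G μ)
    {U : Σ X : BanachSpace.{w, v} 𝕜, StrongRep 𝕜 G X} (hU : U ∈ R.reps) :
    ‖U.2.integrated μ f‖ ≤ R.sigma f :=
  le_ciSup (R.bddAbove f) (⟨U, hU⟩ : R.reps)

theorem RepClass.sigma_nonneg (R : RepClass.{w, u, v} 𝕜 G) (f : ConvAlgebra 𝕜 G μ) :
    0 ≤ R.sigma f :=
  Real.iSup_nonneg fun _ => norm_nonneg _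

theorem RepClass.sigma_le (R : RepClass.{w, u, v} 𝕜 G) {f : ConvAlgebra 𝕜 G μ} {C : ℝ}
    (h : ∀ U ∈ R.reps, ‖U.2.integrated μ f‖ ≤ C) : R.sigma f ≤ C := by
  have := R.nonempty.to_subtype
  exact ciSup_le fun U => h U.1 U.2

/-- `σ` as a seminorm. -/
def RepClass.seminorm (μ : Measure G) [μ.IsHaarMeasure] (R : RepClass.{w, u, v} 𝕜 G) :
    Seminorm 𝕜 (ConvAlgebra 𝕜 G μ) :=
  Seminorm.of R.sigma
    (fun f g => R.sigma_le fun U hU => by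
      rw [map_add]
      exact (norm_add_le _ _).trans (add_le_add (R.norm_le_sigma f hU) (R.norm_le_sigma g hU)))
    (fun c f => by
      simp only [sigma, map_smul, norm_smul]
      exact (Real.mul_iSup_of_nonneg (norm_nonneg c) _).symm)

theorem RepClass.sigma_mul_le (R : RepClass.{w, u, v} 𝕜 G) (f g : ConvAlgebra 𝕜 G μ) :
    R.sigma (f * g) ≤ R.sigma f * R.sigma g :=
  R.sigma_le fun U hU => by
    rw [map_mul]
    exact (norm_mul_le _ _).trans (mul_le_mul (R.norm_le_sigma f hU) (R.norm_le_sigma g hU)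
      (norm_nonneg _) (R.sigma_nonneg f))

/-- The convolution algebra, equipped with the seminorm `σ`. -/
def PreCrossed (μ : Measure G) [μ.IsHaarMeasure] (_R : RepClass.{w, u, v} 𝕜 G) :
    Type (max u w) :=
  ConvAlgebra 𝕜 G μ

variable (R : RepClass.{w, u, v} 𝕜 G)

instance : NonUnitalRing (PreCrossed μ R) :=
  inferInstanceAs (NonUnitalRing (ConvAlgebra 𝕜 G μ))

instance : Module 𝕜 (PreCrossed μ R) :=
  inferInstanceAs (Module 𝕜 (ConvAlgebra 𝕜 G μ))

instance : IsScalarTower 𝕜 (PreCrossed μ R) (PreCrossed μ R) :=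
  inferInstanceAs (IsScalarTower 𝕜 (ConvAlgebra 𝕜 G μ) (ConvAlgebra 𝕜 G μ))

instance : SMulCommClass 𝕜 (PreCrossed μ R) (PreCrossed μ R) :=
  inferInstanceAs (SMulCommClass 𝕜 (ConvAlgebra 𝕜 G μ) (ConvAlgebra 𝕜 G μ))

/-- The seminorm `σ` as a group seminorm on `PreCrossed`. -/
def PreCrossed.groupSeminorm : AddGroupSeminorm (PreCrossed μ R) :=
  (R.seminorm μ).toAddGroupSeminorm

instance : SeminormedAddCommGroup (PreCrossed μ R) :=
  (PreCrossed.groupSeminorm R).toSeminormedAddCommGroup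

theorem PreCrossed.norm_def (f : PreCrossed μ R) : ‖f‖ = R.sigma (μ := μ) f := rfl

instance : NonUnitalSeminormedRing (PreCrossed μ R) :=
  { (inferInstance : SeminormedAddCommGroup (PreCrossed μ R)),
    (inferInstance : NonUnitalRing (PreCrossed μ R)) with
    norm_mul_le := R.sigma_mul_le (μ := μ) }

instance : NormedSpace 𝕜 (PreCrossed μ R) where
  norm_smul_le c f := (map_smul_eq_mul (R.seminorm μ) c f).le

/-- The crossed product: the (Hausdorff) completion of the convolution algebra with respect to
the seminorm `σ`, that is, the completion of its quotient by the kernel of `σ` in the norm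
induced by `σ`. -/
def CrossedProduct (μ : Measure G) [μ.IsHaarMeasure] (R : RepClass.{w, u, v} 𝕜 G) :
    Type (max u w) :=
  UniformSpace.Completion (PreCrossed μ R)

namespace CrossedProduct

instance : NormedAddCommGroup (CrossedProduct μ R) :=
  inferInstanceAs (NormedAddCommGroup (UniformSpace.Completion (PreCrossed μ R)))

instance : NormedSpace 𝕜 (CrossedProduct μ R) :=
  inferInstanceAs (NormedSpace 𝕜 (UniformSpace.Completion (PreCrossed μ R)))

instance : CompleteSpace (CrossedProduct μ R) :=
  inferInstanceAs (CompleteSpace (UniformSpace.Completion (PreCrossed μ R)))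

/-- The canonical linear map from the convolution algebra into the crossed product. -/
def qLin (μ : Measure G) [μ.IsHaarMeasure] (R : RepClass.{w, u, v} 𝕜 G) :
    ConvAlgebra 𝕜 G μ →ₗ[𝕜] CrossedProduct μ R :=
  (UniformSpace.Completion.toComplₗᵢ :
    PreCrossed μ R →ₗᵢ[𝕜] UniformSpace.Completion (PreCrossed μ R)).toLinearMap

theorem norm_qLin (f : ConvAlgebra 𝕜 G μ) : ‖qLin μ R f‖ = R.sigma f :=
  (UniformSpace.Completion.toComplₗᵢ :
    PreCrossed μ R →ₗᵢ[𝕜] UniformSpace.Completion (PreCrossed μ R)).norm_map f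

theorem denseRange_qLin : DenseRange (qLin μ R) :=
  UniformSpace.Completion.denseRange_coe (α := PreCrossed μ R)

/-- Left multiplication by an element of the convolution algebra, extended to the completion. -/
def leftMul (f : ConvAlgebra 𝕜 G μ) : CrossedProduct μ R →L[𝕜] CrossedProduct μ R :=
  ((qLin μ R).comp (LinearMap.mulLeft 𝕜 f)).extendOfNorm (qLin μ R)

theorem leftMul_bound (f g : ConvAlgebra 𝕜 G μ) :
    ‖((qLin μ R).comp (LinearMap.mulLeft 𝕜 f)) g‖ ≤ R.sigma f * ‖qLin μ R g‖ := by
  rw [norm_qLin]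
  exact (norm_qLin R (f * g)).trans_le (R.sigma_mul_le f g)

theorem leftMul_q (f g : ConvAlgebra 𝕜 G μ) :
    leftMul R f (qLin μ R g) = qLin μ R (f * g) :=
  LinearMap.extendOfNorm_eq (denseRange_qLin R) ⟨_, leftMul_bound R f⟩ g

theorem norm_leftMul_le (f : ConvAlgebra 𝕜 G μ) : ‖leftMul R f‖ ≤ R.sigma f :=
  LinearMap.opNorm_extendOfNorm_le (denseRange_qLin R) (R.sigma_nonneg f) (leftMul_bound R f)

/-- Two bounded operators on the crossed product that agree on the image of the convolution
algebra are equal. -/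
theorem clm_ext {E : Type*} [NormedAddCommGroup E] [NormedSpace 𝕜 E]
    {S T : CrossedProduct μ R →L[𝕜] E} (h : ∀ f, S (qLin μ R f) = T (qLin μ R f)) : S = T :=
  DFunLike.coe_injective ((denseRange_qLin R).equalizer S.continuous T.continuous (funext h))

/-- `leftMul` as a linear map. -/
def leftMulLin : ConvAlgebra 𝕜 G μ →ₗ[𝕜] (CrossedProduct μ R →L[𝕜] CrossedProduct μ R) where
  toFun := leftMul R
  map_add' f g := clm_ext R fun h => by
    simp only [_root_.add_apply, leftMul_q, add_mul, map_add]
  map_smul' c f := clm_ext R fun h => by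
    simp only [_root_.smul_apply, leftMul_q, smul_mul_assoc, map_smul, RingHom.id_apply]

theorem leftMulLin_bound (f : ConvAlgebra 𝕜 G μ) :
    ‖leftMulLin R f‖ ≤ 1 * ‖qLin μ R f‖ := by
  rw [one_mul, norm_qLin]
  exact norm_leftMul_le R f

/-- The multiplication of the crossed product, as a bounded bilinear map: the continuous
extension of the convolution product. -/
def mulCLM : CrossedProduct μ R →L[𝕜] CrossedProduct μ R →L[𝕜] CrossedProduct μ R :=
  (leftMulLin R).extendOfNorm (qLin μ R)

instance : Mul (CrossedProduct μ R) where
  mul a b := mulCLM R a b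

theorem mul_def (a b : CrossedProduct μ R) : a * b = mulCLM R a b := rfl

theorem q_mul (f g : ConvAlgebra 𝕜 G μ) :
    qLin μ R f * qLin μ R g = qLin μ R (f * g) := by
  rw [mul_def, mulCLM, LinearMap.extendOfNorm_eq (denseRange_qLin R) ⟨_, leftMulLin_bound R⟩ f]
  exact leftMul_q R f g

theorem norm_mul_le_aux (a b : CrossedProduct μ R) : ‖a * b‖ ≤ ‖a‖ * ‖b‖ := by
  have h := LinearMap.norm_extendOfNorm_apply_le (denseRange_qLin R) 1 (leftMulLin_bound R) a
  rw [one_mul] at h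
  exact ((mulCLM R a).le_opNorm b).trans (mul_le_mul_of_nonneg_right h (norm_nonneg b))

theorem continuous_mul_aux :
    Continuous fun p : CrossedProduct μ R × CrossedProduct μ R => p.1 * p.2 :=
  (mulCLM R).continuous₂

/-- The crossed product is a Banach algebra. -/
instance : NonUnitalNormedRing (CrossedProduct μ R) :=
  { (inferInstance : NormedAddCommGroup (CrossedProduct μ R)),
    (inferInstance : Mul (CrossedProduct μ R)) with
    norm_mul_le := norm_mul_le_aux R
    left_distrib := fun a b c => by simp only [mul_def, map_add]
    right_distrib := fun a b c => by simp only [mul_def, map_add, _root_.add_apply]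
    zero_mul := fun a => by simp only [mul_def, map_zero, _root_.zero_apply]
    mul_zero := fun a => by simp only [mul_def, map_zero]
    mul_assoc := fun a b c => by
      have hc := continuous_mul_aux (μ := μ) R
      refine (denseRange_qLin R).induction_on₃ (p := fun a b c => a * b * c = a * (b * c))
        (isClosed_eq ?_ ?_) (fun f g h => ?_) a b c
      · exact hc.comp ((hc.comp (continuous_fst.prodMk
          (continuous_fst.comp continuous_snd))).prodMk (continuous_snd.comp continuous_snd))
      · exact hc.comp (continuous_fst.prodMk (hc.comp ((continuous_fst.comp continuous_snd).prodMk
          (continuous_snd.comp continuous_snd))))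
      · simp only [q_mul, mul_assoc] }

instance : IsScalarTower 𝕜 (CrossedProduct μ R) (CrossedProduct μ R) where
  smul_assoc c a b := by
    simp only [smul_eq_mul, mul_def, map_smul, _root_.smul_apply]

instance : SMulCommClass 𝕜 (CrossedProduct μ R) (CrossedProduct μ R) where
  smul_comm c a b := by
    simp only [smul_eq_mul, mul_def, map_smul]

/-- The canonical homomorphism `q` from the convolution algebra into the crossed product. -/
def q (μ : Measure G) [μ.IsHaarMeasure] (R : RepClass.{w, u, v} 𝕜 G) :
    ConvAlgebra 𝕜 G μ →ₙₐ[𝕜] CrossedProduct μ R where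
  toFun := qLin μ R
  map_smul' := map_smul (qLin μ R)
  map_zero' := map_zero (qLin μ R)
  map_add' := map_add (qLin μ R)
  map_mul' f g := (q_mul R f g).symm

end CrossedProduct

/-! ### The representation of the crossed product induced by a group representation -/

variable {R} {X : BanachSpace.{w, v} 𝕜}

/-- The integrated form of `U` is bounded with respect to the seminorm `σ` of the class `R`. -/
def StrongRep.IsContinuousFor (μ : Measure G) [μ.IsHaarMeasure] (R : RepClass.{w, u, v} 𝕜 G)
    (U : StrongRep 𝕜 G X) : Prop :=
  ∃ C : ℝ, ∀ f : ConvAlgebra 𝕜 G μ, ‖U.integrated μ f‖ ≤ C * R.sigma f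

theorem StrongRep.isContinuousFor_of_mem {U : Σ X : BanachSpace.{w, v} 𝕜, StrongRep 𝕜 G X}
    (hU : U ∈ R.reps) : U.2.IsContinuousFor μ R :=
  ⟨1, fun f => by rw [one_mul]; exact R.norm_le_sigma f hU⟩

/-- The integrated form as a linear map. -/
def StrongRep.integratedLin (μ : Measure G) [μ.IsHaarMeasure] (U : StrongRep 𝕜 G X) :
    ConvAlgebra 𝕜 G μ →ₗ[𝕜] (X →L[𝕜] X) :=
  (U.integrated μ : ConvAlgebra 𝕜 G μ →ₗ[𝕜] (X →L[𝕜] X))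

/-- The continuous extension of the integrated form to the crossed product. -/
def StrongRep.inducedCLM (μ : Measure G) [μ.IsHaarMeasure] (R : RepClass.{w, u, v} 𝕜 G)
    (U : StrongRep 𝕜 G X) : CrossedProduct μ R →L[𝕜] (X →L[𝕜] X) :=
  (U.integratedLin μ).extendOfNorm (CrossedProduct.q μ R : ConvAlgebra 𝕜 G μ →ₗ[𝕜] _)

theorem StrongRep.inducedCLM_q {U : StrongRep 𝕜 G X} (hU : U.IsContinuousFor μ R)
    (f : ConvAlgebra 𝕜 G μ) :
    U.inducedCLM μ R (CrossedProduct.q μ R f) = U.integrated μ f := by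
  obtain ⟨C, hC⟩ := hU
  refine LinearMap.extendOfNorm_eq
    (e := (CrossedProduct.q μ R : ConvAlgebra 𝕜 G μ →ₗ[𝕜] CrossedProduct μ R))
    (CrossedProduct.denseRange_qLin R) ⟨C, fun f => ?_⟩ f
  exact (hC f).trans_eq (congrArg (C * ·) (CrossedProduct.norm_qLin R f).symm)

/-- The bounded representation of the crossed product induced by an `R`-continuous `U`; it is
determined by `q(f) ↦ U(f)`. -/
def StrongRep.induced (U : StrongRep 𝕜 G X) (hU : U.IsContinuousFor μ R) :
    AlgRep 𝕜 (CrossedProduct μ R) X where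
  toFun := U.inducedCLM μ R
  map_smul' := map_smul (U.inducedCLM μ R)
  map_zero' := map_zero (U.inducedCLM μ R)
  map_add' := map_add (U.inducedCLM μ R)
  map_mul' a b := by
    have hc := (U.inducedCLM μ R).continuous
    refine (CrossedProduct.denseRange_qLin R).induction_on₂
      (p := fun a b => U.inducedCLM μ R (a * b) = U.inducedCLM μ R a * U.inducedCLM μ R b)
      (isClosed_eq ?_ ?_) (fun f g => ?_) a b
    · exact hc.comp (CrossedProduct.continuous_mul_aux R)
    · exact (hc.comp continuous_fst).mul (hc.comp continuous_snd)
    · have h := U.inducedCLM_q hU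
      calc _ = U.inducedCLM μ R (CrossedProduct.q μ R (f * g)) :=
            congrArg (U.inducedCLM μ R) (CrossedProduct.q_mul R f g)
        _ = U.inducedCLM μ R (CrossedProduct.q μ R f) *
            U.inducedCLM μ R (CrossedProduct.q μ R g) := by
              rw [h, h, h, map_mul (U.integrated μ)]

theorem StrongRep.induced_q {U : StrongRep 𝕜 G X} (hU : U.IsContinuousFor μ R)
    (f : ConvAlgebra 𝕜 G μ) :
    U.induced hU (CrossedProduct.q μ R f) = U.integrated μ f :=
  U.inducedCLM_q hU f

end Crossed

/-! ### Group Banach algebras -/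

section GroupAlgebra

variable {𝕜 : Type w} [RCLike 𝕜] (G : Type u) [Group G] [TopologicalSpace G]

/-- All pairs `(X, U)` with `X` in the class `𝓧` and `U` an isometric strongly continuous
representation of `G` on `X`. -/
def isometricReps (𝓧 : Set (BanachSpace.{w, v} 𝕜)) :
    Set (Σ X : BanachSpace.{w, v} 𝕜, StrongRep 𝕜 G X) :=
  {U | U.1 ∈ 𝓧 ∧ U.2.IsIsometric}

/-- The isometric strongly continuous representations in spaces from a non-empty class `𝓧` form
a non-empty uniformly bounded class. -/
def isometricClass (𝓧 : Set (BanachSpace.{w, v} 𝕜)) (h𝓧 : 𝓧.Nonempty) :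
    RepClass.{w, u, v} 𝕜 G where
  reps := isometricReps G 𝓧
  nonempty := by
    obtain ⟨X, hX⟩ := h𝓧
    exact ⟨⟨X, StrongRep.trivial 𝕜 G X⟩, hX, fun r x => by
      simp [StrongRep.op, StrongRep.trivial]⟩
  bounded := by
    refine ⟨fun _ => 1, fun K _ => ⟨1, ?_⟩, fun U hU r => ?_⟩
    · rintro _ ⟨_, _, rfl⟩
      exact le_rfl
    · refine ContinuousLinearMap.opNorm_le_bound _ (by simp) fun x => ?_
      rw [hU.2 r x]
      simp

variable {G} [IsTopologicalGroup G] [LocallyCompactSpace G] [MeasurableSpace G] [BorelSpace G]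

/-- The group Banach algebra of `G` associated with the non-empty class `𝓧`. -/
abbrev GroupBanachAlgebra (μ : Measure G) [μ.IsHaarMeasure] (𝓧 : Set (BanachSpace.{w, v} 𝕜))
    (h𝓧 : 𝓧.Nonempty) : Type (max u w) :=
  CrossedProduct μ (isometricClass G 𝓧 h𝓧)

/-- The representation of the group Banach algebra induced by an isometric strongly continuous
representation of `G` on a space from `𝓧`. -/
def isometricReps.induced (μ : Measure G) [μ.IsHaarMeasure] {𝓧 : Set (BanachSpace.{w, v} 𝕜)}
    (h𝓧 : 𝓧.Nonempty) (U : isometricReps G 𝓧) :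
    AlgRep 𝕜 (GroupBanachAlgebra μ 𝓧 h𝓧) U.1.1 :=
  StrongRep.induced (μ := μ) (R := isometricClass G 𝓧 h𝓧) U.1.2
    (StrongRep.isContinuousFor_of_mem (R := isometricClass G 𝓧 h𝓧) U.2)

end GroupAlgebra

end BanachCrossed

end

noncomputable section

open MeasureTheory Function Set Filter Topology
open scoped TensorProduct

namespace BanachCrossed

/-! ### Elementary rules for group representations -/

section GroupReps

variable {𝕜 : Type w} [RCLike 𝕜] {G : Type u} [Group G] [TopologicalSpace G]
  {X : BanachSpace.{w, v} 𝕜}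

/-! Everything rests on bump functions shrinking to a point. If `F` is continuous on `G`, then `F r`
is a limit of integrals of `F` against normalized bumps at `r`. Applied to `s ↦ U_s x`, this
recovers `U_r` from the operators `U(f)`, which yields injectivity, non-degeneracy (take `r = 1`),
and the transfer of invariant subspaces and intertwiners; density of the image of `q` then carries
these from `C_c(G)` to the whole algebra.

For surjectivity, let `T` be non-degenerate and contractive, and let `L_r` be left translation. The
only candidate is `U_r T(q f)x = T(q(L_r f))x`. Bumps `u` at the identity satisfy `σ(L_r u) ≤ 1` and
`L_r u * f = L_r(u * f) → L_r f`. Hence `∑ T(q(L_r f_i))x_i` is the limit of `T(q(L_r u)) ∑ T(q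
f_i)x_i`, and its norm is at most that of `∑ T(q f_i)x_i` (`norm_tensorAction_translate_le`). So
`U_r` is well defined and contractive on a dense subspace and extends; since `U_{r⁻¹}` is
contractive too, `U_r` is isometric. Strong continuity comes from continuity of `r ↦ q(L_r f)`.

Finally, `q(f * g) = ∫ f(s) q(L_s g) ds` (`integral_smul_apply_q_translate`) gives `U(f) T(q g)x =
T(q f) T(q g)x`, so the integrated form of `U` is `T ∘ q` and `T` is induced by `U`. -/

theorem StrongRep.op_mul (U : StrongRep 𝕜 G X) (r t : G) (x : X) :
    U.op (r * t) x = U.op r (U.op t x) := by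
  simp [StrongRep.op]

theorem StrongRep.op_one (U : StrongRep 𝕜 G X) (x : X) : U.op 1 x = x := by
  simp [StrongRep.op]

theorem StrongRep.ext_op {U V : StrongRep 𝕜 G X} (h : ∀ r x, U.op r x = V.op r x) : U = V :=
  StrongRep.ext (MonoidHom.ext fun r => Units.ext (ContinuousLinearMap.ext (h r)))

end GroupReps

/-! ### Translations, bumps and recovery of values from integrals -/

section Approximation

variable {𝕜 : Type w} [RCLike 𝕜] {G : Type u} [Group G] [TopologicalSpace G]
  [IsTopologicalGroup G] [LocallyCompactSpace G] [MeasurableSpace G] [BorelSpace G]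
  {μ : Measure G} [μ.IsHaarMeasure]

namespace ConvAlgebra

/-- Left translation `(L_r f)(s) = f(r⁻¹ s)`. -/
def translate (r : G) : ConvAlgebra 𝕜 G μ →ₗ[𝕜] ConvAlgebra 𝕜 G μ where
  toFun f :=
    ({ toFun := fun s => f (r⁻¹ * s)
       continuous_toFun := f.continuous.comp (continuous_const.mul continuous_id)
       hasCompactSupport' := f.hasCompactSupport.comp_homeomorph (Homeomorph.mulLeft r⁻¹) } :
      CompactlySupportedContinuousMap G 𝕜)
  map_add' _ _ := rfl
  map_smul' _ _ := rfl

theorem translate_apply (r : G) (f : ConvAlgebra 𝕜 G μ) (s : G) :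
    translate r f s = f (r⁻¹ * s) := rfl

theorem translate_one (f : ConvAlgebra 𝕜 G μ) : translate 1 f = f := by
  ext s
  simp [translate_apply]

theorem translate_mul (r t : G) (f : ConvAlgebra 𝕜 G μ) :
    translate (r * t) f = translate r (translate t f) := by
  ext s
  simp [translate_apply, mul_assoc]

theorem translate_conv (r : G) (f g : ConvAlgebra 𝕜 G μ) :
    translate r (f * g) = translate r f * g := by
  ext s
  rw [translate_apply, mul_apply, mul_apply,
    ← integral_mul_left_eq_self (fun t => translate r f t * g (t⁻¹ * s)) r]
  simp [translate_apply, mul_assoc]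

/-- Translation is continuous in mean. -/
theorem tendsto_integral_norm_translate_sub (f : ConvAlgebra 𝕜 G μ) (r : G) :
    Tendsto (fun t => ∫ s, ‖(translate t f - translate r f) s‖ ∂μ) (𝓝 r) (𝓝 0) := by
  obtain ⟨K, hK, hrK⟩ := exists_compact_mem_nhds r
  have hc : ContinuousOn (fun t => ∫ s, ‖f (t⁻¹ * s) - f (r⁻¹ * s)‖ ∂μ) K := by
    -- Restricting `t` to a compact neighbourhood `K` of `r` confines the supports of all the
    -- translates to the single compact set `K * tsupport f`.
    refine continuousOn_integral_of_compact_support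
      (k := (fun p : G × G => p.1 * p.2) '' (K ×ˢ tsupport f))
      ((hK.prod f.hasCompactSupport).image continuous_mul) ?_ ?_
    · refine Continuous.continuousOn ?_
      have := f.continuous
      exact ((this.comp (continuous_fst.inv.mul continuous_snd)).sub
        (this.comp (continuous_const.mul continuous_snd))).norm
    · intro t s ht hs
      have key : ∀ t ∈ K, f (t⁻¹ * s) = 0 := fun t ht => by
        refine image_eq_zero_of_notMem_tsupport fun h => hs ⟨(t, t⁻¹ * s), ⟨ht, h⟩, by simp⟩
      rw [key t ht, key r (mem_of_mem_nhds hrK), sub_zero, norm_zero]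
  have h := (hc.continuousAt hrK).tendsto
  simp only [sub_self, norm_zero, integral_zero] at h
  exact h

/-- Normalized bump functions supported in a given neighbourhood. -/
theorem exists_bump [T2Space G] {r : G} {N : Set G} (hN : N ∈ 𝓝 r) :
    ∃ u : ConvAlgebra 𝕜 G μ, (∀ s ∉ N, u s = 0) ∧ ∫ s, u s ∂μ = 1 ∧ ∫ s, ‖u s‖ ∂μ = 1 := by
  obtain ⟨φ, h1, h0, hcs, hφ⟩ := exists_continuous_one_zero_of_isCompact
    (isCompact_singleton (x := r)) (t := (interior N)ᶜ) isOpen_interior.isClosed_compl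
    (by simpa [mem_interior_iff_mem_nhds] using hN)
  -- The Urysohn function can be normalized because Haar measure charges every non-empty open set
  -- and `φ r = 1`.
  have hpos : 0 < ∫ s, φ s ∂μ :=
    φ.continuous.integral_pos_of_hasCompactSupport_nonneg_nonzero hcs (fun s => (hφ s).1)
      (x := r) (by rw [h1 rfl]; exact one_ne_zero)
  set c := ∫ s, φ s ∂μ with hc
  let u : ConvAlgebra 𝕜 G μ :=
    ({ toFun := fun s => ((c⁻¹ * φ s : ℝ) : 𝕜)
       continuous_toFun := RCLike.continuous_ofReal.comp (continuous_const.mul φ.continuous)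
       hasCompactSupport' := by
        refine hcs.mono fun s hs h => hs ?_
        simp [h] } : CompactlySupportedContinuousMap G 𝕜)
  have hu : ∀ s, u s = ((c⁻¹ * φ s : ℝ) : 𝕜) := fun _ => rfl
  have hint : ∫ s, c⁻¹ * φ s ∂μ = 1 := by
    rw [integral_const_mul, ← hc, inv_mul_cancel₀ hpos.ne']
  refine ⟨u, fun s hs => ?_, ?_, ?_⟩
  · rw [hu, h0 (fun h => hs (interior_subset h))]
    simp
  · simp_rw [hu]
    rw [integral_ofReal, hint, RCLike.ofReal_one]
  · rw [← hint]
    congr 1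
    ext s
    rw [hu, RCLike.norm_ofReal, abs_of_nonneg (mul_nonneg (inv_nonneg.2 hpos.le) (hφ s).1)]

/-- A normalized function supported where `F` is close to `y` integrates `F` to about `y`. -/
theorem norm_integral_smul_sub_le {E : Type*} [NormedAddCommGroup E] [NormedSpace 𝕜 E]
    [NormedSpace ℝ E] [IsScalarTower ℝ 𝕜 E] [CompleteSpace E] {u : ConvAlgebra 𝕜 G μ} {N : Set G}
    (h0 : ∀ s ∉ N, u s = 0) (h1 : ∫ s, u s ∂μ = 1) (h2 : ∫ s, ‖u s‖ ∂μ = 1)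
    {F : G → E} (hF : Continuous F) {y : E} {ε : ℝ} (hε : ∀ s ∈ N, ‖F s - y‖ ≤ ε) :
    ‖∫ s, u s • F s ∂μ - y‖ ≤ ε := by
  have hy : ∫ s, u s • y ∂μ = y := by rw [integral_smul_const, h1, one_smul]
  have hu : Integrable u μ := u.continuous.integrable_of_hasCompactSupport u.hasCompactSupport
  -- Total mass one lets `y` be absorbed into the integral; the bound then uses that the `L¹` norm
  -- is also one.
  have hd : ∫ s, u s • F s ∂μ - y = ∫ s, u s • (F s - y) ∂μ := by
    simp_rw [smul_sub]
    rw [integral_sub (u.integrable_smul hF) (u.integrable_smul continuous_const), hy]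
  calc ‖∫ s, u s • F s ∂μ - y‖ ≤ ∫ s, ‖u s‖ * ε ∂μ := by
        rw [hd]
        refine norm_integral_le_of_norm_le (hu.norm.mul_const _) (.of_forall fun s => ?_)
        rw [norm_smul]
        by_cases hs : s ∈ N
        · exact mul_le_mul_of_nonneg_left (hε s hs) (norm_nonneg _)
        · simp [h0 s hs]
    _ = ε := by rw [integral_mul_const, h2, one_mul]

/-- The value `F r` lies in the closure of the integrals of `F` against test functions. -/
theorem exists_norm_integral_smul_sub_le [T2Space G] {E : Type*} [NormedAddCommGroup E]
    [NormedSpace 𝕜 E] [NormedSpace ℝ E] [IsScalarTower ℝ 𝕜 E] [CompleteSpace E]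
    {F : G → E} (hF : Continuous F) (μ : Measure G) [μ.IsHaarMeasure] (r : G) {ε : ℝ}
    (hε : 0 < ε) :
    ∃ u : ConvAlgebra 𝕜 G μ, ‖∫ s, u s • F s ∂μ - F r‖ ≤ ε := by
  have hN : {s | ‖F s - F r‖ ≤ ε} ∈ 𝓝 r := by
    have := (hF.tendsto r).eventually (Metric.closedBall_mem_nhds _ hε)
    simpa [dist_eq_norm, Filter.Eventually] using this
  obtain ⟨u, h0, h1, h2⟩ := exists_bump (𝕜 := 𝕜) (μ := μ) hN
  exact ⟨u, norm_integral_smul_sub_le h0 h1 h2 hF fun s hs => hs⟩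

theorem mem_of_forall_integral_smul_mem [T2Space G] {E : Type*} [NormedAddCommGroup E]
    [NormedSpace 𝕜 E] [NormedSpace ℝ E] [IsScalarTower ℝ 𝕜 E] [CompleteSpace E]
    {F : G → E} (hF : Continuous F) {S : Set E} (hS : IsClosed S)
    (h : ∀ f : ConvAlgebra 𝕜 G μ, ∫ s, f s • F s ∂μ ∈ S) (r : G) : F r ∈ S := by
  refine hS.closure_subset (Metric.mem_closure_iff.2 fun ε hε => ?_)
  obtain ⟨u, hu⟩ := exists_norm_integral_smul_sub_le (𝕜 := 𝕜) hF μ r (half_pos hε)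
  refine ⟨_, h u, ?_⟩
  rw [dist_comm, dist_eq_norm]
  linarith

/-- Continuous functions are determined by their integrals against test functions. -/
theorem eq_of_forall_integral_smul_eq [T2Space G] {E : Type*} [NormedAddCommGroup E]
    [NormedSpace 𝕜 E] [NormedSpace ℝ E] [IsScalarTower ℝ 𝕜 E] [CompleteSpace E]
    {F F' : G → E} (hF : Continuous F) (hF' : Continuous F')
    (h : ∀ f : ConvAlgebra 𝕜 G μ, ∫ s, f s • F s ∂μ = ∫ s, f s • F' s ∂μ) (r : G) :
    F r = F' r := by
  refine sub_eq_zero.1 (mem_of_forall_integral_smul_mem (𝕜 := 𝕜) (μ := μ) (hF.sub hF')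
    (S := {0}) isClosed_singleton (fun f => ?_) r)
  simp only [Pi.sub_apply, smul_sub]
  rw [integral_sub (f.integrable_smul hF) (f.integrable_smul hF'), h f, sub_self]
  rfl

end ConvAlgebra

/-! ### Group representations versus their integrated forms -/

section Reps

variable {X Y : BanachSpace.{w, v} 𝕜}

theorem StrongRep.integrated_translate (U : StrongRep 𝕜 G X) (r : G) (f : ConvAlgebra 𝕜 G μ)
    (x : X) :
    U.integrated μ (f.translate r) x = U.op r (U.integrated μ f x) := by
  rw [integrated_apply, integrated_apply,
    ← integral_mul_left_eq_self (fun s => f.translate r s • U.op s x) r]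
  refine Eq.trans ?_ (ContinuousLinearMap.integral_comp_comm (U.op r)
      (f.integrable_smul (U.continuous_apply x)))
  congr 1
  ext s
  rw [map_smul, ConvAlgebra.translate_apply, inv_mul_cancel_left, op_mul]

theorem StrongRep.closedInvariantSubspaces_iff [T2Space G] (U : StrongRep 𝕜 G X)
    {Z : Submodule 𝕜 X} (hZ : IsClosed (Z : Set X)) :
    (∀ (r : G), ∀ z ∈ Z, U.op r z ∈ Z) ↔
      ∀ (f : ConvAlgebra 𝕜 G μ), ∀ z ∈ Z, U.integrated μ f z ∈ Z := by
  refine ⟨fun h f z hz => ?_, fun h r z hz => ?_⟩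
  · have := hZ.completeSpace_coe
    -- The closed subspace `Z` is itself a Banach space, so the integral can be formed inside it and
    -- then pushed through the inclusion.
    let F : G → Z := fun s => ⟨U.op s z, h s z hz⟩
    have hF : Continuous F := (U.continuous_apply z).subtype_mk _
    have := ContinuousLinearMap.integral_comp_comm Z.subtypeL (f.integrable_smul (μ := μ) hF)
    rw [integrated_apply]
    exact this ▸ Subtype.property _
  · exact ConvAlgebra.mem_of_forall_integral_smul_mem (𝕜 := 𝕜) (μ := μ)
      (U.continuous_apply z) hZ (fun f => h f z hz) r

theorem StrongRep.intertwines_iff [T2Space G] (U : StrongRep 𝕜 G X) (V : StrongRep 𝕜 G Y)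
    (Φ : X →L[𝕜] Y) :
    (∀ r : G, (V.op r).comp Φ = Φ.comp (U.op r)) ↔
      ∀ f : ConvAlgebra 𝕜 G μ, (V.integrated μ f).comp Φ = Φ.comp (U.integrated μ f) := by
  have key : ∀ (f : ConvAlgebra 𝕜 G μ) (x : X),
      Φ (U.integrated μ f x) = ∫ s, f s • Φ (U.op s x) ∂μ := fun f x => by
    rw [integrated_apply]
    refine (ContinuousLinearMap.integral_comp_comm Φ
      (f.integrable_smul (U.continuous_apply x))).symm.trans ?_
    simp_rw [map_smul]
    rfl
  refine ⟨fun h f => ContinuousLinearMap.ext fun x => ?_,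
    fun h r => ContinuousLinearMap.ext fun x => ?_⟩
  · have h' : ∀ s, V.op s (Φ x) = Φ (U.op s x) := fun s => DFunLike.congr_fun (h s) x
    rw [ContinuousLinearMap.comp_apply, ContinuousLinearMap.comp_apply, key, integrated_apply]
    simp_rw [h']
  · refine ConvAlgebra.eq_of_forall_integral_smul_eq (𝕜 := 𝕜) (μ := μ)
      (F := fun r => V.op r (Φ x)) (F' := fun r => Φ (U.op r x))
      (V.continuous_apply (Φ x)) (Φ.continuous.comp (U.continuous_apply x)) (fun f => ?_) r
    rw [← key]
    exact DFunLike.congr_fun (h f) x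

end Reps

end Approximation

/-! ### The filter of bumps at the identity -/

section Bumps

variable {𝕜 : Type w} [RCLike 𝕜] {G : Type u} [Group G] [TopologicalSpace G] [MeasurableSpace G]
  {μ : Measure G}

/-- The filter of normalized functions concentrating at the identity. -/
def bumpFilter (𝕜 : Type w) [RCLike 𝕜] (μ : Measure G) : Filter (ConvAlgebra 𝕜 G μ) :=
  (𝓝 (1 : G)).lift' fun N =>
    {u | (∀ s ∉ N, u s = 0) ∧ ∫ s, u s ∂μ = 1 ∧ ∫ s, ‖u s‖ ∂μ = 1}

theorem eventually_bumpFilter {N : Set G} (hN : N ∈ 𝓝 (1 : G)) :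
    ∀ᶠ u in bumpFilter 𝕜 μ,
      (∀ s ∉ N, u s = 0) ∧ ∫ s, u s ∂μ = 1 ∧ ∫ s, ‖u s‖ ∂μ = 1 :=
  mem_lift' hN

end Bumps

/-! ### Approximate identities in the group Banach algebra -/

section GroupAlgebra

variable {𝕜 : Type w} [RCLike 𝕜] {G : Type u} [Group G] [TopologicalSpace G]
  [IsTopologicalGroup G] [LocallyCompactSpace G] [MeasurableSpace G] [BorelSpace G]
  {μ : Measure G} [μ.IsHaarMeasure]
  {𝓧 : Set (BanachSpace.{w, v} 𝕜)} {h𝓧 : 𝓧.Nonempty}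

open ConvAlgebra

theorem CrossedProduct.denseRange_q (R : RepClass.{w, u, v} 𝕜 G) :
    DenseRange (CrossedProduct.q μ R) :=
  CrossedProduct.denseRange_qLin R

theorem CrossedProduct.norm_q (R : RepClass.{w, u, v} 𝕜 G) (f : ConvAlgebra 𝕜 G μ) :
    ‖CrossedProduct.q μ R f‖ = R.sigma f :=
  CrossedProduct.norm_qLin R f

theorem bumpFilter_neBot [T2Space G] (μ : Measure G) [μ.IsHaarMeasure] :
    (bumpFilter 𝕜 μ).NeBot := by
  refine (lift'_neBot_iff fun N M hNM u hu => ?_).2 fun N hN => exists_bump hN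
  exact ⟨fun s hs => hu.1 s fun h => hs (hNM h), hu.2⟩

namespace isometricClass

theorem sigma_le_integral_norm (f : ConvAlgebra 𝕜 G μ) :
    (isometricClass G 𝓧 h𝓧).sigma f ≤ ∫ s, ‖f s‖ ∂μ := by
  refine RepClass.sigma_le _ fun U hU => ?_
  refine ContinuousLinearMap.opNorm_le_bound _ (integral_nonneg fun _ => norm_nonneg _)
    fun x => ?_
  have := U.2.norm_integral_le f (M := 1) (fun s _ => ?_) x
  · rwa [mul_one] at this
  · exact ContinuousLinearMap.opNorm_le_bound _ zero_le_one fun y => by rw [hU.2 s y, one_mul]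

/-- Holds because `U(L_r f) = U_r U(f)` and every `U_r` in the class is isometric. -/
theorem sigma_translate_le (r : G) (f : ConvAlgebra 𝕜 G μ) :
    (isometricClass G 𝓧 h𝓧).sigma (translate r f) ≤ (isometricClass G 𝓧 h𝓧).sigma f := by
  refine RepClass.sigma_le _ fun U hU => ?_
  refine ContinuousLinearMap.opNorm_le_bound _ (RepClass.sigma_nonneg _ _) fun x => ?_
  rw [StrongRep.integrated_translate, hU.2 r]
  exact ((U.2.integrated μ f).le_opNorm x).trans
    (mul_le_mul_of_nonneg_right (RepClass.norm_le_sigma _ f hU) (norm_nonneg x))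

theorem tendsto_sigma_translate_sub (f : ConvAlgebra 𝕜 G μ) (r : G) :
    Tendsto (fun t => (isometricClass G 𝓧 h𝓧).sigma (translate t f - translate r f))
      (𝓝 r) (𝓝 0) :=
  squeeze_zero (fun _ => RepClass.sigma_nonneg _ _) (fun _ => sigma_le_integral_norm _)
    (tendsto_integral_norm_translate_sub f r)

theorem continuous_q_translate (f : ConvAlgebra 𝕜 G μ) :
    Continuous fun r => CrossedProduct.q μ (isometricClass G 𝓧 h𝓧) (translate r f) := by
  refine continuous_iff_continuousAt.2 fun r => ?_
  refine tendsto_iff_norm_sub_tendsto_zero.2 ?_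
  simp_rw [← map_sub, CrossedProduct.norm_q]
  exact tendsto_sigma_translate_sub f r

/-- Since `U_s U(f) = U(L_s f)`, the vector `U(u * f)x` is the `u`-average of `U(L_s f)x`. Its
distance to `U(f)x` is controlled by `σ(L_s f - f)`, uniformly over the class, which is what the
supremum `σ` requires. -/
theorem sigma_bump_mul_sub_le {u f : ConvAlgebra 𝕜 G μ} {N : Set G}
    (h0 : ∀ s ∉ N, u s = 0) (h1 : ∫ s, u s ∂μ = 1) (h2 : ∫ s, ‖u s‖ ∂μ = 1) {ε : ℝ} (hε : 0 ≤ ε)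
    (h : ∀ s ∈ N, (isometricClass G 𝓧 h𝓧).sigma (translate s f - f) ≤ ε) :
    (isometricClass G 𝓧 h𝓧).sigma (u * f - f) ≤ ε := by
  refine RepClass.sigma_le _ fun U hU => ?_
  refine ContinuousLinearMap.opNorm_le_bound _ hε fun x => ?_
  have hx : U.2.integrated μ (u * f - f) x =
      ∫ s, u s • U.2.op s (U.2.integrated μ f x) ∂μ - U.2.integrated μ f x := by
    rw [map_sub, map_mul]
    rfl
  rw [hx]
  refine norm_integral_smul_sub_le h0 h1 h2 (U.2.continuous_apply _) fun s hs => ?_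
  change ‖U.2.op s (U.2.integrated μ f x) - _‖ ≤ _
  rw [← StrongRep.integrated_translate, ← _root_.sub_apply, ← map_sub]
  exact (ContinuousLinearMap.le_opNorm _ _).trans (mul_le_mul_of_nonneg_right
    ((RepClass.norm_le_sigma _ _ hU).trans (h s hs)) (norm_nonneg _))

theorem eventually_sigma_le_one :
    ∀ᶠ u in bumpFilter 𝕜 μ, (isometricClass G 𝓧 h𝓧).sigma u ≤ 1 :=
  (eventually_bumpFilter univ_mem).mono fun u hu => (sigma_le_integral_norm u).trans_eq hu.2.2

theorem tendsto_sigma_bump_mul_sub (f : ConvAlgebra 𝕜 G μ) :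
    Tendsto (fun u => (isometricClass G 𝓧 h𝓧).sigma (u * f - f)) (bumpFilter 𝕜 μ) (𝓝 0) := by
  refine tendsto_order.2 ⟨fun a ha => .of_forall fun u => ha.trans_le (RepClass.sigma_nonneg _ _),
    fun ε hε => ?_⟩
  have h := (tendsto_sigma_translate_sub (h𝓧 := h𝓧) f 1).eventually (gt_mem_nhds (half_pos hε))
  simp only [translate_one] at h
  filter_upwards [eventually_bumpFilter (𝕜 := 𝕜) (μ := μ) h] with u hu
  exact (sigma_bump_mul_sub_le hu.1 hu.2.1 hu.2.2 (half_pos hε).le fun s hs => le_of_lt hs).trans_lt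
    (half_lt_self hε)

/-- The bumps form a left approximate identity, uniformly under translations. -/
theorem tendsto_q_translate_bump_mul (r : G) (f : ConvAlgebra 𝕜 G μ) :
    Tendsto (fun u => CrossedProduct.q μ (isometricClass G 𝓧 h𝓧) (translate r u) *
        CrossedProduct.q μ (isometricClass G 𝓧 h𝓧) f) (bumpFilter 𝕜 μ)
      (𝓝 (CrossedProduct.q μ (isometricClass G 𝓧 h𝓧) (translate r f))) := by
  refine tendsto_iff_norm_sub_tendsto_zero.2 ?_
  refine squeeze_zero (fun _ => norm_nonneg _) (fun u => ?_) (tendsto_sigma_bump_mul_sub (h𝓧 := h𝓧) f)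
  rw [← map_mul, ← translate_conv, ← map_sub, ← map_sub, CrossedProduct.norm_q]
  exact sigma_translate_le r _

end isometricClass

/-! ### From isometric group representations to algebra representations -/

namespace isometricReps

theorem induced_q (U : isometricReps G 𝓧) (f : ConvAlgebra 𝕜 G μ) :
    induced μ h𝓧 U (CrossedProduct.q μ (isometricClass G 𝓧 h𝓧) f) = U.1.2.integrated μ f :=
  StrongRep.induced_q _ f

theorem norm_induced_le (U : isometricReps G 𝓧) (a : GroupBanachAlgebra μ 𝓧 h𝓧) :
    ‖induced μ h𝓧 U a‖ ≤ ‖a‖ := by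
  have := LinearMap.norm_extendOfNorm_apply_le (f := U.1.2.integratedLin μ)
    (e := CrossedProduct.qLin μ (isometricClass G 𝓧 h𝓧))
    (CrossedProduct.denseRange_qLin _) 1 (fun f => ?_) a
  · rwa [one_mul] at this
  · rw [one_mul, CrossedProduct.norm_qLin]
    exact RepClass.norm_le_sigma (isometricClass G 𝓧 h𝓧) f U.2

theorem continuous_induced (U : isometricReps G 𝓧) : Continuous (induced μ h𝓧 U) :=
  (StrongRep.inducedCLM μ (isometricClass G 𝓧 h𝓧) U.1.2).continuous

/-- The induced representations separate the points of the group Banach algebra. -/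
theorem eq_of_forall_induced_eq {a b : GroupBanachAlgebra μ 𝓧 h𝓧}
    (h : ∀ U : isometricReps G 𝓧, induced μ h𝓧 U a = induced μ h𝓧 U b) : a = b := by
  refine sub_eq_zero.1 (norm_le_zero_iff.1 (le_of_forall_pos_le_add fun ε hε => ?_))
  obtain ⟨f, hf⟩ := Metric.denseRange_iff.1
    (CrossedProduct.denseRange_q (μ := μ) (isometricClass G 𝓧 h𝓧)) (a - b) (ε / 2) (half_pos hε)
  rw [dist_eq_norm] at hf
  -- On the image of `q` the norm is a supremum over the class, and each `U(f)` is within `ε / 2` of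
  -- the image of `a - b`, which vanishes.
  have hσ : ‖CrossedProduct.q μ (isometricClass G 𝓧 h𝓧) f‖ ≤ ε / 2 := by
    rw [CrossedProduct.norm_q]
    refine RepClass.sigma_le _ fun U hU => ?_
    rw [← induced_q (h𝓧 := h𝓧) ⟨U, hU⟩ f]
    have h0 : induced μ h𝓧 ⟨U, hU⟩ (a - b) = 0 := by rw [map_sub, h, sub_self]
    have := norm_induced_le ⟨U, hU⟩ (a - b - CrossedProduct.q μ (isometricClass G 𝓧 h𝓧) f)
    rw [map_sub, h0, zero_sub, norm_neg] at this
    exact this.trans hf.le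
  have := norm_add_le (a - b - CrossedProduct.q μ (isometricClass G 𝓧 h𝓧) f)
    (CrossedProduct.q μ (isometricClass G 𝓧 h𝓧) f)
  rw [sub_add_cancel] at this
  linarith

/-- Each `x = U_1 x` is a limit of vectors `U(f)x`. -/
theorem isNondegenerate_induced [T2Space G] (U : isometricReps G 𝓧) :
    (induced μ h𝓧 U).IsNondegenerate := by
  intro x
  have h := mem_of_forall_integral_smul_mem (𝕜 := 𝕜) (μ := μ) (U.1.2.continuous_apply x)
    (isClosed_closure (s := (Submodule.span 𝕜 {y : U.1.1 | ∃ a x, induced μ h𝓧 U a x = y} :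
      Set U.1.1))) (fun f => subset_closure (Submodule.subset_span
        ⟨CrossedProduct.q μ _ f, x, by rw [induced_q]; rfl⟩)) 1
  simpa using h

theorem induced_mem_ndContractiveReps [T2Space G] (U : isometricReps G 𝓧) :
    (⟨U.1.1, induced μ h𝓧 U⟩ : Σ X : BanachSpace.{w, v} 𝕜,
      AlgRep 𝕜 (GroupBanachAlgebra μ 𝓧 h𝓧) X) ∈
      ndContractiveReps (GroupBanachAlgebra μ 𝓧 h𝓧) 𝓧 :=
  ⟨U.2.1, isNondegenerate_induced U, norm_induced_le U⟩

theorem induced_injective [T2Space G] :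
    Injective (fun U : isometricReps G 𝓧 => (⟨U.1.1, induced μ h𝓧 U⟩ :
      Σ X : BanachSpace.{w, v} 𝕜, AlgRep 𝕜 (GroupBanachAlgebra μ 𝓧 h𝓧) X)) := by
  rintro ⟨⟨X, U⟩, hU⟩ ⟨⟨Y, V⟩, hV⟩ h
  obtain ⟨rfl, h⟩ := Sigma.mk.inj h
  have h := eq_of_heq h
  congr
  refine StrongRep.ext_op fun r x => eq_of_forall_integral_smul_eq (𝕜 := 𝕜) (μ := μ)
    (U.continuous_apply x) (V.continuous_apply x) (fun f => ?_) r
  have := DFunLike.congr_fun (DFunLike.congr_fun h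
    (CrossedProduct.q μ (isometricClass G 𝓧 h𝓧) f)) x
  rw [induced_q, induced_q] at this
  exact this

theorem closedInvariantSubspaces_induced [T2Space G] (U : isometricReps G 𝓧) :
    (induced μ h𝓧 U).closedInvariantSubspaces = U.1.2.closedInvariantSubspaces := by
  ext Z
  refine and_congr_right fun hZ => ?_
  rw [StrongRep.closedInvariantSubspaces_iff (μ := μ) U.1.2 hZ]
  refine ⟨fun h f z hz => ?_, fun h a z hz => ?_⟩
  · rw [← induced_q (h𝓧 := h𝓧)]
    exact h _ z hz
  · refine (CrossedProduct.denseRange_q (μ := μ) (isometricClass G 𝓧 h𝓧)).induction_on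
      (p := fun a => induced μ h𝓧 U a z ∈ Z) a ?_ fun f => ?_
    · exact hZ.preimage ((continuous_induced U).clm_apply continuous_const)
    · rw [induced_q]
      exact h f z hz

theorem intertwiners_induced [T2Space G] (U V : isometricReps G 𝓧) :
    (induced μ h𝓧 U).intertwiners (induced μ h𝓧 V) = U.1.2.intertwiners V.1.2 := by
  ext Φ
  refine Iff.trans ?_ (StrongRep.intertwines_iff (μ := μ) U.1.2 V.1.2 Φ).symm
  refine ⟨fun h f => ?_, fun h a => ?_⟩
  · rw [← induced_q (h𝓧 := h𝓧), ← induced_q (h𝓧 := h𝓧)]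
    exact h _
  · refine (CrossedProduct.denseRange_q (μ := μ) (isometricClass G 𝓧 h𝓧)).induction_on
      (p := fun a => (induced μ h𝓧 V a).comp Φ = Φ.comp (induced μ h𝓧 U a)) a ?_ fun f => ?_
    · exact isClosed_eq ((continuous_induced V).clm_comp continuous_const)
        (continuous_const.clm_comp (continuous_induced U))
    · rw [induced_q, induced_q]
      exact h f

end isometricReps

/-- In the group Banach algebra, `f * g` is the integral of the translates of `g` against `f`. -/
theorem integral_smul_apply_q_translate {E : Type*} [NormedAddCommGroup E] [NormedSpace 𝕜 E]
    [NormedSpace ℝ E] [IsScalarTower ℝ 𝕜 E] [CompleteSpace E]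
    (Ψ : GroupBanachAlgebra μ 𝓧 h𝓧 →L[𝕜] E) (f g : ConvAlgebra 𝕜 G μ) :
    ∫ s, f s • Ψ (CrossedProduct.q μ _ (translate s g)) ∂μ = Ψ (CrossedProduct.q μ _ (f * g)) := by
  let _ : NormedSpace ℝ (GroupBanachAlgebra μ 𝓧 h𝓧) := NormedSpace.restrictScalars ℝ 𝕜 _
  have _ : IsScalarTower ℝ 𝕜 (GroupBanachAlgebra μ 𝓧 h𝓧) := RestrictScalars.isScalarTower ℝ 𝕜 _
  have hc := isometricClass.continuous_q_translate (h𝓧 := h𝓧) g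
  have key : ∫ s, f s • CrossedProduct.q μ (isometricClass G 𝓧 h𝓧) (translate s g) ∂μ =
      CrossedProduct.q μ (isometricClass G 𝓧 h𝓧) (f * g) := by
    -- Elements of the completion have no pointwise values, so the two sides are compared under
    -- every induced representation, whose orbit maps commute with the integral.
    refine isometricReps.eq_of_forall_induced_eq fun U => ContinuousLinearMap.ext fun x => ?_
    have h := ContinuousLinearMap.integral_comp_comm
      ((ContinuousLinearMap.apply 𝕜 U.1.1 x).comp
        (StrongRep.inducedCLM μ (isometricClass G 𝓧 h𝓧) U.1.2)) (f.integrable_smul (μ := μ) hc)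
    refine h.symm.trans ?_
    rw [isometricReps.induced_q, map_mul, mul_apply_eq_comp, StrongRep.integrated_apply]
    congr 1
    ext s
    rw [map_smul, ← StrongRep.integrated_translate, ← isometricReps.induced_q (h𝓧 := h𝓧)]
    rfl
  rw [← key]
  refine Eq.trans ?_ (ContinuousLinearMap.integral_comp_comm Ψ (f.integrable_smul (μ := μ) hc))
  simp_rw [map_smul]

end GroupAlgebra

/-! ### From algebra representations back to the group -/

section Disintegration

variable {𝕜 : Type w} [RCLike 𝕜] {G : Type u} [Group G] [TopologicalSpace G]
  [IsTopologicalGroup G] [LocallyCompactSpace G] [MeasurableSpace G] [BorelSpace G]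
  {μ : Measure G} [μ.IsHaarMeasure]
  {𝓧 : Set (BanachSpace.{w, v} 𝕜)} {h𝓧 : 𝓧.Nonempty}
  {X : BanachSpace.{w, v} 𝕜} {T : AlgRep 𝕜 (GroupBanachAlgebra μ 𝓧 h𝓧) X}

open ConvAlgebra

namespace AlgRep

/-- The orbit map `a ↦ T(a)x` of a contractive representation. -/
def orbitCLM (hT : T.IsContractive) (x : X) : GroupBanachAlgebra μ 𝓧 h𝓧 →L[𝕜] X :=
  LinearMap.mkContinuous
    { toFun := fun a => T a x
      map_add' := fun a b => by rw [map_add, _root_.add_apply]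
      map_smul' := fun c a => by rw [map_smul, _root_.smul_apply]; rfl } ‖x‖ fun a => by
    rw [mul_comm]
    exact ((T a).le_opNorm x).trans (mul_le_mul_of_nonneg_right (hT a) (norm_nonneg x))

theorem orbitCLM_apply (hT : T.IsContractive) (x : X) (a : GroupBanachAlgebra μ 𝓧 h𝓧) :
    orbitCLM hT x a = T a x := rfl

/-- The linear map `f ⊗ x ↦ T(q(L f)) x`. -/
def tensorAction (T : AlgRep 𝕜 (GroupBanachAlgebra μ 𝓧 h𝓧) X)
    (L : ConvAlgebra 𝕜 G μ →ₗ[𝕜] ConvAlgebra 𝕜 G μ) : ConvAlgebra 𝕜 G μ ⊗[𝕜] X →ₗ[𝕜] X :=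
  TensorProduct.lift ((ContinuousLinearMap.coeLM 𝕜).comp
    ((T : GroupBanachAlgebra μ 𝓧 h𝓧 →ₗ[𝕜] (X →L[𝕜] X)).comp
      ((CrossedProduct.qLin μ (isometricClass G 𝓧 h𝓧)).comp L)))

theorem tensorAction_tmul (L : ConvAlgebra 𝕜 G μ →ₗ[𝕜] ConvAlgebra 𝕜 G μ)
    (f : ConvAlgebra 𝕜 G μ) (x : X) :
    T.tensorAction L (f ⊗ₜ x) = T (CrossedProduct.q μ _ (L f)) x := rfl

theorem denseRange_tensorAction (hT : T.IsContractive) (hn : T.IsNondegenerate) :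
    DenseRange (T.tensorAction LinearMap.id) := by
  have hle : Submodule.span 𝕜 {y : X | ∃ (a : GroupBanachAlgebra μ 𝓧 h𝓧) (x : X), T a x = y} ≤
      (LinearMap.range (T.tensorAction LinearMap.id)).topologicalClosure := by
    refine Submodule.span_le.2 ?_
    rintro _ ⟨a, x, rfl⟩
    refine (CrossedProduct.denseRange_q (μ := μ) (isometricClass G 𝓧 h𝓧)).induction_on
      (p := fun a => T a x ∈
        closure (LinearMap.range (T.tensorAction LinearMap.id) : Set X)) a ?_ fun f => ?_
    · exact isClosed_closure.preimage (orbitCLM hT x).continuous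
    · exact subset_closure ⟨f ⊗ₜ x, rfl⟩
  have h : Dense (closure (LinearMap.range (T.tensorAction LinearMap.id) : Set X)) := hn.mono hle
  have h' := dense_closure.1 h
  rwa [LinearMap.coe_range] at h'

/-- Bounded operators agreeing on all `T(q(f))x` are equal. -/
theorem clm_ext_of_isNondegenerate (hT : T.IsContractive) (hn : T.IsNondegenerate)
    {E : Type*} [NormedAddCommGroup E] [NormedSpace 𝕜 E] {A B : X →L[𝕜] E}
    (h : ∀ (f : ConvAlgebra 𝕜 G μ) (x : X),
      A (T (CrossedProduct.q μ _ f) x) = B (T (CrossedProduct.q μ _ f) x)) : A = B := by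
  refine DFunLike.coe_injective ((denseRange_tensorAction hT hn).equalizer A.continuous
    B.continuous (funext fun t => ?_))
  have : A.toLinearMap.comp (T.tensorAction LinearMap.id) =
      B.toLinearMap.comp (T.tensorAction LinearMap.id) := TensorProduct.ext' h
  exact DFunLike.congr_fun this t

/-- The left side depends on `t` only through the vector it represents in `X`, so the limit does as
well. This is why translation descends from tensors to vectors. -/
theorem tendsto_bump_tensorAction (hT : T.IsContractive) (r : G)
    (t : ConvAlgebra 𝕜 G μ ⊗[𝕜] X) :
    Tendsto (fun u => T (CrossedProduct.q μ _ (translate r u)) (T.tensorAction LinearMap.id t))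
      (bumpFilter 𝕜 μ) (𝓝 (T.tensorAction (translate r) t)) := by
  induction t with
  | zero => simpa using tendsto_const_nhds
  | tmul f x =>
    have h := ((orbitCLM hT x).continuous.tendsto _).comp
      (isometricClass.tendsto_q_translate_bump_mul (h𝓧 := h𝓧) r f)
    simp only [comp_def, orbitCLM_apply, map_mul] at h
    exact h
  | add t t' h h' => simpa only [map_add] using h.add h'

/-- Gives well-definedness and contractivity of `groupOp` at once. The operators `T(q(L_r u))` have
norm at most `σ(u) ≤ 1`, and the bound survives the limit because the bump filter is proper. -/
theorem norm_tensorAction_translate_le [T2Space G] (hT : T.IsContractive) (r : G)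
    (t : ConvAlgebra 𝕜 G μ ⊗[𝕜] X) :
    ‖T.tensorAction (translate r) t‖ ≤ 1 * ‖T.tensorAction LinearMap.id t‖ := by
  have := bumpFilter_neBot (𝕜 := 𝕜) μ
  refine le_of_tendsto (tendsto_bump_tensorAction hT r t).norm ?_
  filter_upwards [isometricClass.eventually_sigma_le_one (h𝓧 := h𝓧)] with u hu
  refine (ContinuousLinearMap.le_opNorm _ _).trans
    (mul_le_mul_of_nonneg_right ((hT _).trans ?_) (norm_nonneg _))
  rw [CrossedProduct.norm_q]
  exact (isometricClass.sigma_translate_le r u).trans hu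

/-- The operator `U_r` determined by `U_r T(q(f))x = T(q(L_r f))x`. -/
def groupOp (T : AlgRep 𝕜 (GroupBanachAlgebra μ 𝓧 h𝓧) X) (r : G) : X →L[𝕜] X :=
  (T.tensorAction (translate r)).extendOfNorm (T.tensorAction LinearMap.id)

variable [T2Space G] (hT : T.IsContractive) (hn : T.IsNondegenerate)
include hT hn

theorem groupOp_tensorAction (r : G) (t : ConvAlgebra 𝕜 G μ ⊗[𝕜] X) :
    T.groupOp r (T.tensorAction LinearMap.id t) = T.tensorAction (translate r) t := by
  unfold groupOp
  exact LinearMap.extendOfNorm_eq (f := T.tensorAction (translate r))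
    (e := T.tensorAction LinearMap.id) (denseRange_tensorAction hT hn)
    ⟨1, norm_tensorAction_translate_le hT r⟩ t

theorem groupOp_apply (r : G) (f : ConvAlgebra 𝕜 G μ) (x : X) :
    T.groupOp r (T (CrossedProduct.q μ _ f) x) = T (CrossedProduct.q μ _ (translate r f)) x := by
  have h := groupOp_tensorAction hT hn r (f ⊗ₜ x)
  rwa [tensorAction_tmul, tensorAction_tmul] at h

theorem norm_groupOp_apply_le (r : G) (x : X) : ‖T.groupOp r x‖ ≤ ‖x‖ := by
  unfold groupOp
  refine (LinearMap.norm_extendOfNorm_apply_le (f := T.tensorAction (translate r))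
    (e := T.tensorAction LinearMap.id) (denseRange_tensorAction hT hn) 1
    (norm_tensorAction_translate_le hT r) x).trans_eq (one_mul _)

theorem groupOp_one : T.groupOp 1 = 1 :=
  clm_ext_of_isNondegenerate hT hn fun f x => by
    rw [groupOp_apply hT hn, translate_one, one_apply_eq_self]

theorem groupOp_mul (r t : G) : T.groupOp (r * t) = T.groupOp r * T.groupOp t :=
  clm_ext_of_isNondegenerate hT hn fun f x => by
    rw [mul_apply_eq_comp, groupOp_apply hT hn, groupOp_apply hT hn, groupOp_apply hT hn,
      translate_mul]

theorem continuous_groupOp_apply (x : X) : Continuous fun r => T.groupOp r x := by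
  have hd : ∀ t, Continuous fun r => T.groupOp r (T.tensorAction LinearMap.id t) := fun t => by
    induction t with
    | zero => simpa using continuous_const
    | tmul f x =>
      simp only [tensorAction_tmul, LinearMap.id_apply, groupOp_apply hT hn]
      exact (orbitCLM hT x).continuous.comp (isometricClass.continuous_q_translate f)
    | add t t' h h' =>
      simp only [map_add]
      exact h.add h'
  refine continuous_iff_continuousAt.2 fun r => Metric.continuousAt_iff'.2 fun ε hε => ?_
  -- Uniform contractivity of the operators carries continuity from the dense subspace to `x`.
  obtain ⟨t, ht⟩ := Metric.denseRange_iff.1 (denseRange_tensorAction hT hn) x (ε / 3) (by positivity)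
  filter_upwards [Metric.continuousAt_iff'.1 (hd t).continuousAt (ε / 3) (by positivity)] with s hs
  have key : ∀ s, dist (T.groupOp s x) (T.groupOp s (T.tensorAction LinearMap.id t)) < ε / 3 :=
    fun s => by
      rw [dist_eq_norm, ← map_sub]
      exact (norm_groupOp_apply_le hT hn s _).trans_lt (by rwa [← dist_eq_norm])
  have h1 := dist_triangle4 (T.groupOp s x) (T.groupOp s (T.tensorAction LinearMap.id t))
    (T.groupOp r (T.tensorAction LinearMap.id t)) (T.groupOp r x)
  have h2 := key s
  have h3 := key r
  rw [dist_comm] at h3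
  linarith

/-- The strongly continuous representation of `G` underlying a non-degenerate contractive
representation of the group Banach algebra. -/
def groupRep : StrongRep 𝕜 G X where
  -- Invertibility is automatic: a monoid homomorphism defined on a group takes values in units.
  hom := MonoidHom.toHomUnits
    { toFun := T.groupOp
      map_one' := groupOp_one hT hn
      map_mul' := groupOp_mul hT hn }
  continuous_apply := continuous_groupOp_apply hT hn

theorem groupRep_op (r : G) : (groupRep hT hn).op r = T.groupOp r := rfl

theorem isIsometric_groupRep : (groupRep hT hn).IsIsometric := fun r x => by
  refine le_antisymm (norm_groupOp_apply_le hT hn r x) ?_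
  have h := norm_groupOp_apply_le hT hn r⁻¹ ((groupRep hT hn).op r x)
  rwa [← groupRep_op hT hn, ← StrongRep.op_mul, inv_mul_cancel, StrongRep.op_one] at h

/-- By non-degeneracy it suffices to test on vectors `T(q g)x`, where both sides become `T(q(f *
g))x`. -/
theorem integrated_groupRep (f : ConvAlgebra 𝕜 G μ) :
    (groupRep hT hn).integrated μ f = T (CrossedProduct.q μ _ f) :=
  clm_ext_of_isNondegenerate hT hn fun g x => by
    rw [StrongRep.integrated_apply]
    simp_rw [groupRep_op, groupOp_apply hT hn]
    rw [← mul_apply_eq_comp, ← map_mul, ← map_mul]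
    exact integral_smul_apply_q_translate (orbitCLM hT x) f g

theorem induced_groupRep (hX : X ∈ 𝓧) :
    isometricReps.induced μ h𝓧 ⟨⟨X, groupRep hT hn⟩, hX, isIsometric_groupRep hT hn⟩ = T := by
  refine DFunLike.ext _ _ fun a => ContinuousLinearMap.ext fun x => ?_
  refine (CrossedProduct.denseRange_q (μ := μ) (isometricClass G 𝓧 h𝓧)).induction_on
    (p := fun a => isometricReps.induced μ h𝓧
      ⟨⟨X, groupRep hT hn⟩, hX, isIsometric_groupRep hT hn⟩ a x = T a x) a ?_ fun f => ?_
  · exact isClosed_eq ((isometricReps.continuous_induced _).clm_apply continuous_const)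
      (orbitCLM hT x).continuous
  · rw [isometricReps.induced_q, integrated_groupRep]

end AlgRep

end Disintegration

end BanachCrossed

end

theorem theoremt {𝕜 : Type w} [RCLike 𝕜] {G : Type u} [Group G] [TopologicalSpace G]
    [IsTopologicalGroup G] [LocallyCompactSpace G] [T2Space G] [MeasurableSpace G] [BorelSpace G]
    (μ : MeasureTheory.Measure G) [μ.IsHaarMeasure]
    (𝓧 : Set (BanachCrossed.BanachSpace.{w, v} 𝕜)) (h𝓧 : 𝓧.Nonempty) :
    Set.BijOn
      (fun U : BanachCrossed.isometricReps G 𝓧 =>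
        (⟨U.1.1, BanachCrossed.isometricReps.induced μ h𝓧 U⟩ :
          Σ X : BanachCrossed.BanachSpace.{w, v} 𝕜,
            BanachCrossed.AlgRep 𝕜 (BanachCrossed.GroupBanachAlgebra μ 𝓧 h𝓧) X))
      Set.univ
      (BanachCrossed.ndContractiveReps (BanachCrossed.GroupBanachAlgebra μ 𝓧 h𝓧) 𝓧) ∧
    (∀ U : BanachCrossed.isometricReps G 𝓧,
      (BanachCrossed.isometricReps.induced μ h𝓧 U).closedInvariantSubspaces =
        U.1.2.closedInvariantSubspaces) ∧
    (∀ U V : BanachCrossed.isometricReps G 𝓧,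
      (BanachCrossed.isometricReps.induced μ h𝓧 U).intertwiners
          (BanachCrossed.isometricReps.induced μ h𝓧 V) =
        U.1.2.intertwiners V.1.2) := by
  refine ⟨⟨fun U _ => BanachCrossed.isometricReps.induced_mem_ndContractiveReps U,
      BanachCrossed.isometricReps.induced_injective.injOn, ?_⟩,
    BanachCrossed.isometricReps.closedInvariantSubspaces_induced,
    BanachCrossed.isometricReps.intertwiners_induced⟩
  rintro ⟨X, T⟩ ⟨hX, hn, hT⟩
  exact ⟨⟨⟨X, _⟩, hX, BanachCrossed.AlgRep.isIsometric_groupRep hT hn⟩, Set.mem_univ _,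
    congrArg (Sigma.mk X) (BanachCrossed.AlgRep.induced_groupRep hT hn hX)⟩
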